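/- Let $k,n\ge 1$ be natural numbers and let $K=\bigcup_{i=1}^k K_i\subset\mathbb{R}^n$ be the union of $k$ compact, path-connected (in particular non-empty), pairwise disjoint sets $K_i$. A linear functional $L:\mathcal V\to\mathbb R$ on a vector space of real functions on a set $\mathcal X\subseteq\mathbb R^m$ is called an $S$-moment functional ($S\subseteq\mathcal X$) if there is a non-negative Borel measure $\mu$ on $\mathcal X$ with $\operatorname{supp}\mu\subseteq S$ such that every $v\in\mathcal V$ is $\mu$-integrable and $L(v)=\int v\,d\mu$. For $g:K\to\mathbb R$ let $\mathbb R[g]=\{p\circ g: p\in\mathbb R[t]\}$. Then there exists a Borel measurable function $$g:K\to I_k:=\bigcup_{i=1}^{k}\left[\frac{2i-2}{2k-1},\frac{2i-1}{2k-1}\right]\subseteq[0,1]$$ such that for every linear subspace $\mathcal V\subseteq C(K,\mathbb R)$ with $1\in\mathcal V$ and every linear functional $L:\mathcal V\to\mathbb R$ the following are equivalent: (i) $L$ is a $K$-moment functional. (ii) $L$ extends continuously to a linear functional $\overline L:\mathcal V+\mathbb R[g]\to\mathbb R$ such that the linear functional $\tilde L:\mathbb R[t]\to\mathbb R$ defined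 by $\tilde L(t^d):=\overline L(g^d)$ for all $d\in\mathbb N_0$ is a $[0,1]$-moment functional. Here "extends continuously" means: $\overline L|_{\mathcal V}=L$, and whenever $p_j\in\mathbb R[t]$ $(j\in\mathbb N)$ converge uniformly on $[0,1]$ to some $p\in C([0,1],\mathbb R)$ with $p\circ g\in\mathcal V$, then $\overline L(p_j\circ g)\to L(p\circ g)$. -/

import Mathlib

open Filter Topology MeasureTheory Polynomial

/-- A linear functional `L` on a vector space `V` whose elements are regarded as real functions on
`X` (through the linear map `ev`) is a moment functional if it is represented by a (non-negative)
measure on `X`: every member of `V` is integrable, and `L` is integration. -/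
def IsMomentFunctional {X V : Type*} [MeasurableSpace X] [AddCommGroup V] [Module ℝ V]
    (ev : V →ₗ[ℝ] (X → ℝ)) (L : V →ₗ[ℝ] ℝ) : Prop :=
  ∃ μ : Measure X, ∀ v : V, Integrable (ev v) μ ∧ L v = ∫ x, ev v x ∂μ

/-- The same with a representing measure whose support lies in `S ⊆ X`: an `S`-moment
functional. -/
def IsMomentFunctionalOn {X V : Type*} [TopologicalSpace X] [MeasurableSpace X]
    [AddCommGroup V] [Module ℝ V]
    (S : Set X) (ev : V →ₗ[ℝ] (X → ℝ)) (L : V →ₗ[ℝ] ℝ) : Prop :=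
  ∃ μ : Measure X, μ.support ⊆ S ∧ ∀ v : V, Integrable (ev v) μ ∧ L v = ∫ x, ev v x ∂μ

/-- The linear map `p ↦ p ∘ g` from real polynomials in one variable to functions on `X`. -/
noncomputable def polyComp {X : Type*} (g : X → ℝ) : ℝ[X] →ₗ[ℝ] (X → ℝ) :=
  LinearMap.pi fun x => Polynomial.leval (g x)

/-- `ℝ[g]`: the space of all functions `p ∘ g`, with `p` a real polynomial in one variable. -/
noncomputable def polySpace {X : Type*} (g : X → ℝ) : Submodule ℝ (X → ℝ) :=
  LinearMap.range (polyComp g)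

/-- For a linear functional `Lbar` on `V + ℝ[g]`, the linear functional `p ↦ Lbar (p ∘ g)` on
polynomials, i.e. the one determined by `t ^ d ↦ Lbar (g ^ d)`. -/
noncomputable def inducedFunctional {X : Type*} {V : Submodule ℝ (X → ℝ)} {g : X → ℝ}
    (Lbar : ↥(V ⊔ polySpace g) →ₗ[ℝ] ℝ) : ℝ[X] →ₗ[ℝ] ℝ :=
  Lbar ∘ₗ Submodule.inclusion (le_sup_right : polySpace g ≤ V ⊔ polySpace g) ∘ₗ
    (polyComp g).rangeRestrict

/-- `Lbar` is a continuous extension of `L : V → ℝ` to `V + ℝ[g]`: it agrees with `L` on `V`, and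
whenever polynomials `P i` converge uniformly on `[0,1]` to a continuous function `p` with
`p ∘ g = v ∈ V`, then `Lbar (P i ∘ g)` converges to `L v`. -/
structure IsContinuousExtension {X : Type*} {V : Submodule ℝ (X → ℝ)} (g : X → ℝ)
    (L : V →ₗ[ℝ] ℝ) (Lbar : ↥(V ⊔ polySpace g) →ₗ[ℝ] ℝ) : Prop where
  extends_L : ∀ v : V, Lbar (Submodule.inclusion le_sup_left v) = L v
  tendsto : ∀ (P : ℕ → ℝ[X]) (p : ℝ → ℝ) (v : V),
    ContinuousOn p (Set.Icc 0 1) →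
    TendstoUniformlyOn (fun i t => (P i).eval t) p atTop (Set.Icc 0 1) →
    (∀ x, (v : X → ℝ) x = p (g x)) →
    Tendsto (fun i => inducedFunctional Lbar (P i)) atTop (𝓝 (L v))

/-- `I_k`, the union of the intervals `[(2i-2)/(2k-1), (2i-1)/(2k-1)]` for `i = 1, …, k`. -/
def intervalUnion (k : ℕ) : Set ℝ :=
  ⋃ i ∈ Finset.Icc 1 k,
    Set.Icc ((2 * (i : ℝ) - 2) / (2 * (k : ℝ) - 1)) ((2 * (i : ℝ) - 1) / (2 * (k : ℝ) - 1))

/-!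
Let `f` be a continuous surjection of the Cantor space onto `K`, `s` a section of `f`, `e` an
embedding of the Cantor space into `I_k`, and `g = e ∘ s`. Choosing `e (s x)` least on the fibre
over `x` makes `g` Borel. Integration against a representing measure on `K` gives (i) ⇒ (ii).
Conversely, let `ν` represent the functional on `ℝ[t]`. By Weierstrass, `∫ p ∂ν = L (p ∘ g)` for
every continuous `p` with `p ∘ g ∈ V`. Taking for `p` the distance to the range of `e`, for which
`p ∘ g = 0`, shows that `ν` lives on this range, so it can be pulled back along `e` and pushed
forward along `f`. By Tietze, `v ∘ f` extends along `e` to a continuous `q` on the line. Then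
`q ∘ g = v ∘ f ∘ s = v`, so the resulting measure on `K` represents `L`.
-/

theorem tendsto_integral_of_tendstoUniformlyOn {α ι E : Type*} [MeasurableSpace α]
    [NormedAddCommGroup E] [NormedSpace ℝ E] {μ : Measure α} [IsFiniteMeasure μ] {l : Filter ι}
    {F : ι → α → E} {f : α → E} {s : Set α} (hs : ∀ᵐ x ∂μ, x ∈ s) (hF : ∀ i, Integrable (F i) μ)
    (hf : Integrable f μ) (h : TendstoUniformlyOn F f l s) :
    Tendsto (fun i => ∫ x, F i x ∂μ) l (𝓝 (∫ x, f x ∂μ)) := by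
  rw [Metric.tendsto_nhds]
  intro ε hε
  have hpos : 0 < μ.real Set.univ + 1 := by positivity
  filter_upwards [Metric.tendstoUniformlyOn_iff.1 h (ε / (μ.real Set.univ + 1)) (div_pos hε hpos)]
    with i hi
  have hbound : ∀ᵐ x ∂μ, ‖F i x - f x‖ ≤ ε / (μ.real Set.univ + 1) := by
    filter_upwards [hs] with x hx
    rw [← dist_eq_norm, dist_comm]
    exact (hi x hx).le
  rw [dist_eq_norm, ← integral_sub (hF i) hf]
  calc ‖∫ x, (F i x - f x) ∂μ‖ ≤ ε / (μ.real Set.univ + 1) * μ.real Set.univ :=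
        norm_integral_le_of_norm_le_const hbound
    _ < ε / (μ.real Set.univ + 1) * (μ.real Set.univ + 1) :=
        mul_lt_mul_of_pos_left (lt_add_one _) (div_pos hε hpos)
    _ = ε := div_mul_cancel₀ ε hpos.ne'

theorem exists_polynomial_tendstoUniformlyOn {a b : ℝ} {p : ℝ → ℝ}
    (hp : ContinuousOn p (Set.Icc a b)) :
    ∃ P : ℕ → ℝ[X], TendstoUniformlyOn (fun i t => (P i).eval t) p atTop (Set.Icc a b) := by
  choose P hP using fun i : ℕ =>
    exists_polynomial_near_of_continuousOn a b p hp (1 / ((i : ℝ) + 1)) (by positivity)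
  refine ⟨P, Metric.tendstoUniformlyOn_iff.2 fun ε hε => ?_⟩
  filter_upwards [tendsto_one_div_add_atTop_nhds_zero_nat.eventually_lt_const hε] with i hi t ht
  rw [dist_comm, Real.dist_eq]
  exact (hP i t ht).trans hi

theorem integrable_of_ae_mem_isCompact {α E : Type*} [TopologicalSpace α] [MeasurableSpace α]
    [OpensMeasurableSpace α] [T2Space α] [NormedAddCommGroup E] {μ : Measure α}
    [IsFiniteMeasureOnCompacts μ] {s : Set α} (hs : IsCompact s) (hμ : ∀ᵐ x ∂μ, x ∈ s)
    {f : α → E} (hf : ContinuousOn f s) : Integrable f μ := by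
  have hint : IntegrableOn f s μ := hf.integrableOn_compact hs
  rwa [IntegrableOn, Measure.restrict_eq_self_of_ae_mem hμ] at hint

theorem ae_mem_of_integral_infDist_eq_zero {α : Type*} [PseudoMetricSpace α] [MeasurableSpace α]
    {μ : Measure α} {F : Set α} (hF : IsClosed F) (hne : F.Nonempty)
    (hint : Integrable (fun x => Metric.infDist x F) μ) (h : ∫ x, Metric.infDist x F ∂μ = 0) :
    ∀ᵐ x ∂μ, x ∈ F := by
  have hzero := (integral_eq_zero_iff_of_nonneg (fun _ => Metric.infDist_nonneg) hint).1 h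
  filter_upwards [hzero] with x hx using (hF.mem_iff_infDist_zero hne).2 hx

theorem exists_section_measurable_comp {X Z α : Type*} [TopologicalSpace X] [T2Space X]
    [MeasurableSpace X] [BorelSpace X] [TopologicalSpace Z] [CompactSpace Z]
    [LinearOrder α] [TopologicalSpace α] [OrderTopology α] [SecondCountableTopology α]
    [MeasurableSpace α] [BorelSpace α] {f : Z → X} (hf : Continuous f)
    (hsurj : Function.Surjective f) {e : Z → α} (he : Continuous e) :
    ∃ s : X → Z, Function.RightInverse s f ∧ Measurable (e ∘ s) := by
  have hmin : ∀ x, ∃ z, f z = x ∧ ∀ w, f w = x → e z ≤ e w := by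
    intro x
    obtain ⟨z, hz, hzmin⟩ := ((isClosed_singleton (x := x)).preimage hf).isCompact.exists_isMinOn
      (hsurj x) he.continuousOn
    exact ⟨z, hz, fun w hw => hzmin hw⟩
  choose s hs hsmin using hmin
  refine ⟨s, hs, measurable_of_Iic fun a => ?_⟩
  have hpreimage : (e ∘ s) ⁻¹' Set.Iic a = f '' (e ⁻¹' Set.Iic a) := by
    ext x
    constructor
    · exact fun h => ⟨s x, h, hs x⟩
    · rintro ⟨z, hz, rfl⟩
      exact (hsmin (f z) z rfl).trans hz
  rw [hpreimage]
  exact ((isClosed_Iic.preimage he).isCompact.image hf).measurableSet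

theorem exists_isClosedEmbedding_nat_bool_of_not_countable {α : Type*} [TopologicalSpace α]
    [PolishSpace α] [MeasurableSpace α] [BorelSpace α] {S : Set α} (hS : MeasurableSet S)
    (hunc : ¬S.Countable) :
    ∃ e : (ℕ → Bool) → α, IsClosedEmbedding e ∧ ∀ z, e z ∈ S := by
  suffices ∃ e : (ℕ → Bool) → α, Set.range e ⊆ S ∧ Continuous e ∧ Function.Injective e by
    obtain ⟨e, heS, he, hinj⟩ := this
    exact ⟨e, he.isClosedEmbedding hinj, fun z => heS ⟨z, rfl⟩⟩
  -- The perfect set theorem for closed sets applies in a finer Polish topology.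
  obtain ⟨τ, hτ, hpolish, hclosed, -⟩ := hS.isClopenable
  obtain ⟨e, heS, he, hinj⟩ :=
    @IsClosed.exists_nat_bool_injection_of_not_countable α τ hpolish S hclosed hunc
  exact ⟨e, heS, continuous_le_rng hτ he, hinj⟩

theorem integral_map_comap_of_comp_eq {X Y Z E : Type*} [MeasurableSpace X] [MeasurableSpace Y]
    [MeasurableSpace Z] [NormedAddCommGroup E] [NormedSpace ℝ E] {ν : Measure Y} {e : Z → Y}
    (he : MeasurableEmbedding e) (hν : ∀ᵐ y ∂ν, y ∈ Set.range e) {f : Z → X} (hf : Measurable f)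
    {v : X → E} (hv : StronglyMeasurable v) {q : Y → E} (hq : ∀ z, q (e z) = v (f z)) :
    ∫ x, v x ∂(ν.comap e).map f = ∫ y, q y ∂ν :=
  calc ∫ x, v x ∂(ν.comap e).map f = ∫ z, v (f z) ∂ν.comap e :=
        integral_map hf.aemeasurable hv.aestronglyMeasurable
    _ = ∫ z, q (e z) ∂ν.comap e := by simp only [hq]
    _ = ∫ y, q y ∂ν := by
        rw [← he.integral_map, he.map_comap, Measure.restrict_eq_self_of_ae_mem hν]

theorem intervalUnion_subset_Icc (k : ℕ) : intervalUnion k ⊆ Set.Icc 0 1 := by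
  refine Set.iUnion₂_subset fun i hi => ?_
  obtain ⟨hi1, hik⟩ := Finset.mem_Icc.1 hi
  have hi1' : (1 : ℝ) ≤ i := by exact_mod_cast hi1
  have hik' : (i : ℝ) ≤ k := by exact_mod_cast hik
  exact Set.Icc_subset_Icc (div_nonneg (by linarith) (by linarith))
    ((div_le_one (by linarith)).2 (by linarith))

theorem measurableSet_intervalUnion (k : ℕ) : MeasurableSet (intervalUnion k) :=
  Finset.measurableSet_biUnion _ fun _ _ => measurableSet_Icc

theorem not_countable_intervalUnion {k : ℕ} (hk : 1 ≤ k) : ¬(intervalUnion k).Countable := by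
  have hk' : (1 : ℝ) ≤ k := by exact_mod_cast hk
  have hsub : Set.Icc 0 (1 / (2 * (k : ℝ) - 1)) ⊆ intervalUnion k :=
    Set.subset_iUnion₂_of_subset 1 (Finset.mem_Icc.2 ⟨le_rfl, hk⟩) (by norm_num)
  exact fun h => (one_div_pos.2 (by linarith)).not_ge
    (Cardinal.Real.Icc_countable_iff.1 (h.mono hsub))

section

variable {X : Type*}

@[simp]
theorem polyComp_apply (g : X → ℝ) (p : ℝ[X]) (x : X) : polyComp g p x = p.eval (g x) := rfl

/-- Integration against `μ` as a linear functional on a space `W` of `μ`-integrable functions. -/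
noncomputable def integralFunctional [MeasurableSpace X] (μ : Measure X) (W : Submodule ℝ (X → ℝ))
    (hW : ∀ w ∈ W, Integrable w μ) : W →ₗ[ℝ] ℝ where
  toFun w := ∫ x, (w : X → ℝ) x ∂μ
  map_add' a b := integral_add (hW a a.2) (hW b b.2)
  map_smul' c a := integral_const_mul c (a : X → ℝ)

variable {V : Submodule ℝ (X → ℝ)} {g : X → ℝ} {L : V →ₗ[ℝ] ℝ}

section

variable [MeasurableSpace X] {μ : Measure X}

theorem inducedFunctional_integralFunctional (hint : ∀ w ∈ V ⊔ polySpace g, Integrable w μ)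
    (p : ℝ[X]) : inducedFunctional (integralFunctional μ _ hint) p = ∫ x, p.eval (g x) ∂μ :=
  rfl

theorem integrable_of_mem_sup_polySpace [IsFiniteMeasure μ] (hg : Measurable g)
    (hgI : ∀ x, g x ∈ Set.Icc (0 : ℝ) 1) (hV : ∀ v ∈ V, Integrable v μ) {w : X → ℝ}
    (hw : w ∈ V ⊔ polySpace g) : Integrable w μ := by
  obtain ⟨v, hv, _, ⟨p, rfl⟩, rfl⟩ := Submodule.mem_sup.1 hw
  have hp : Integrable (fun t => p.eval t) (μ.map g) :=
    integrable_of_ae_mem_isCompact isCompact_Icc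
      ((ae_map_iff hg.aemeasurable measurableSet_Icc).2 (.of_forall hgI)) p.continuousOn
  exact (hV v hv).add (hp.comp_measurable hg)

theorem isContinuousExtension_integralFunctional [IsFiniteMeasure μ]
    (hgI : ∀ x, g x ∈ Set.Icc (0 : ℝ) 1) (hint : ∀ w ∈ V ⊔ polySpace g, Integrable w μ)
    (hL : ∀ v : V, L v = ∫ x, (v : X → ℝ) x ∂μ) :
    IsContinuousExtension g L (integralFunctional μ _ hint) where
  extends_L v := (hL v).symm
  tendsto P p v _ hP hv := by
    have hunif : TendstoUniformlyOn (fun i x => (P i).eval (g x)) v atTop (g ⁻¹' Set.Icc 0 1) :=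
      (funext hv : (v : X → ℝ) = p ∘ g) ▸ hP.comp g
    simp only [inducedFunctional_integralFunctional, hL v]
    exact tendsto_integral_of_tendstoUniformlyOn (.of_forall hgI)
      (fun i => hint _ (Submodule.mem_sup_right ⟨P i, rfl⟩))
      (hint _ (Submodule.mem_sup_left v.2)) hunif

theorem isMomentFunctionalOn_inducedFunctional_integralFunctional (hg : Measurable g) {S : Set ℝ}
    (hS : IsClosed S) (hgS : ∀ x, g x ∈ S) (hint : ∀ w ∈ V ⊔ polySpace g, Integrable w μ) :
    IsMomentFunctionalOn S (polyComp (id : ℝ → ℝ))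
      (inducedFunctional (integralFunctional μ _ hint)) := by
  refine ⟨μ.map g, Measure.support_subset_of_isClosed hS
    ((ae_map_iff hg.aemeasurable hS.measurableSet).2 (.of_forall hgS)), fun p => ?_⟩
  have hp : AEStronglyMeasurable (polyComp (id : ℝ → ℝ) p) (μ.map g) :=
    p.continuous.aestronglyMeasurable
  exact ⟨(integrable_map_measure hp hg.aemeasurable).2
    (hint _ (Submodule.mem_sup_right ⟨p, rfl⟩)), (integral_map hg.aemeasurable hp).symm⟩

theorem IsMomentFunctional.exists_isContinuousExtension (hg : Measurable g)
    (hgI : ∀ x, g x ∈ Set.Icc (0 : ℝ) 1) (h1 : (1 : X → ℝ) ∈ V)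
    (hL : IsMomentFunctional V.subtype L) :
    ∃ Lbar : ↥(V ⊔ polySpace g) →ₗ[ℝ] ℝ, IsContinuousExtension g L Lbar ∧
      IsMomentFunctionalOn (Set.Icc 0 1) (polyComp (id : ℝ → ℝ)) (inducedFunctional Lbar) := by
  obtain ⟨μ, hμ⟩ := hL
  have : IsFiniteMeasure μ :=
    (integrable_const_iff_isFiniteMeasure (one_ne_zero (α := ℝ))).1 (hμ ⟨1, h1⟩).1
  have hint : ∀ w ∈ V ⊔ polySpace g, Integrable w μ := fun w =>
    integrable_of_mem_sup_polySpace hg hgI fun v hv => (hμ ⟨v, hv⟩).1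
  exact ⟨integralFunctional μ _ hint,
    isContinuousExtension_integralFunctional hgI hint fun v => (hμ v).2,
    isMomentFunctionalOn_inducedFunctional_integralFunctional hg isClosed_Icc hgI hint⟩

end

theorem IsMomentFunctionalOn.exists_isFiniteMeasure {S : Set ℝ} {Λ : ℝ[X] →ₗ[ℝ] ℝ}
    (hΛ : IsMomentFunctionalOn S (polyComp (id : ℝ → ℝ)) Λ) :
    ∃ ν : Measure ℝ, IsFiniteMeasure ν ∧ (∀ᵐ t ∂ν, t ∈ S) ∧ ∀ p, Λ p = ∫ t, p.eval t ∂ν := by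
  obtain ⟨ν, hsupp, hν⟩ := hΛ
  have hone : polyComp (id : ℝ → ℝ) 1 = fun _ => 1 := by ext; simp
  exact ⟨ν, (integrable_const_iff_isFiniteMeasure one_ne_zero).1 (hone ▸ (hν 1).1),
    mem_of_superset Measure.support_mem_ae hsupp, fun p => (hν p).2⟩

namespace IsContinuousExtension

section

variable {Lbar : ↥(V ⊔ polySpace g) →ₗ[ℝ] ℝ} {ν : Measure ℝ} [IsFiniteMeasure ν]

theorem apply_eq_integral (hLbar : IsContinuousExtension g L Lbar)
    (hνI : ∀ᵐ t ∂ν, t ∈ Set.Icc (0 : ℝ) 1)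
    (hν : ∀ p : ℝ[X], inducedFunctional Lbar p = ∫ t, p.eval t ∂ν)
    {p : ℝ → ℝ} (hp : ContinuousOn p (Set.Icc 0 1)) (v : V) (hv : ∀ x, (v : X → ℝ) x = p (g x)) :
    L v = ∫ t, p t ∂ν := by
  obtain ⟨P, hP⟩ := exists_polynomial_tendstoUniformlyOn hp
  refine tendsto_nhds_unique (hLbar.tendsto P p v hp hP hv) ?_
  simp only [hν]
  exact tendsto_integral_of_tendstoUniformlyOn hνI
    (fun i => integrable_of_ae_mem_isCompact isCompact_Icc hνI (P i).continuousOn)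
    (integrable_of_ae_mem_isCompact isCompact_Icc hνI hp) hP

theorem ae_mem_of_isClosed (hLbar : IsContinuousExtension g L Lbar)
    (hνI : ∀ᵐ t ∂ν, t ∈ Set.Icc (0 : ℝ) 1)
    (hν : ∀ p : ℝ[X], inducedFunctional Lbar p = ∫ t, p.eval t ∂ν)
    {F : Set ℝ} (hF : IsClosed F) (hne : F.Nonempty) (hgF : ∀ x, g x ∈ F) : ∀ᵐ t ∂ν, t ∈ F := by
  have hd : ContinuousOn (fun t => Metric.infDist t F) (Set.Icc 0 1) :=
    (Metric.continuous_infDist_pt F).continuousOn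
  refine ae_mem_of_integral_infDist_eq_zero hF hne
    (integrable_of_ae_mem_isCompact isCompact_Icc hνI hd) ?_
  rw [← hLbar.apply_eq_integral hνI hν hd 0 fun x => (Metric.infDist_zero_of_mem (hgF x)).symm,
    map_zero]

end

theorem isMomentFunctional {Z : Type*} [TopologicalSpace X] [CompactSpace X]
    [MeasurableSpace X] [BorelSpace X] [TopologicalSpace Z] [Nonempty Z] [MeasurableSpace Z]
    [BorelSpace Z] {f : Z → X} (hf : Continuous f) {e : Z → ℝ} (he : IsClosedEmbedding e)
    {s : X → Z} (hs : Function.RightInverse s f) (hV : ∀ v ∈ V, Continuous v)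
    {Lbar : ↥(V ⊔ polySpace (e ∘ s)) →ₗ[ℝ] ℝ} (hLbar : IsContinuousExtension (e ∘ s) L Lbar)
    (hmom : IsMomentFunctionalOn (Set.Icc 0 1) (polyComp (id : ℝ → ℝ)) (inducedFunctional Lbar)) :
    IsMomentFunctional V.subtype L := by
  obtain ⟨ν, _, hνI, hν⟩ := hmom.exists_isFiniteMeasure
  have hνe : ∀ᵐ t ∂ν, t ∈ Set.range e :=
    hLbar.ae_mem_of_isClosed hνI hν he.isClosed_range (Set.range_nonempty e) fun x => ⟨s x, rfl⟩
  refine ⟨(ν.comap e).map f, fun v => ?_⟩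
  have hv : Continuous (v : X → ℝ) := hV v v.2
  obtain ⟨q, hq⟩ := ContinuousMap.exists_extension he ⟨(v : X → ℝ) ∘ f, hv.comp hf⟩
  have hqe : ∀ z, q (e z) = (v : X → ℝ) (f z) := DFunLike.congr_fun hq
  have hqg : ∀ x, (v : X → ℝ) x = q ((e ∘ s) x) := fun x => by
    rw [Function.comp_apply, hqe, hs x]
  exact ⟨hv.integrable_of_hasCompactSupport (.of_compactSpace _),
    (hLbar.apply_eq_integral hνI hν q.continuous.continuousOn v hqg).trans
      (integral_map_comap_of_comp_eq he.measurableEmbedding hνe hf.measurable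
        hv.stronglyMeasurable hqe).symm⟩

end IsContinuousExtension

end

theorem corollary4p5_general {X : Type*} [TopologicalSpace X] [CompactSpace X]
    [TopologicalSpace.MetrizableSpace X] [Nonempty X] [MeasurableSpace X] [BorelSpace X]
    {S : Set ℝ} (hS : MeasurableSet S) (hunc : ¬S.Countable) (hSI : S ⊆ Set.Icc 0 1) :
    ∃ g : X → ℝ, Measurable g ∧ (∀ x, g x ∈ S) ∧
      ∀ V : Submodule ℝ (X → ℝ), (1 : X → ℝ) ∈ V → (∀ v ∈ V, Continuous v) →
        ∀ L : V →ₗ[ℝ] ℝ,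
          IsMomentFunctional V.subtype L ↔
            ∃ Lbar : ↥(V ⊔ polySpace g) →ₗ[ℝ] ℝ,
              IsContinuousExtension g L Lbar ∧
                IsMomentFunctionalOn (Set.Icc 0 1) (polyComp (id : ℝ → ℝ))
                  (inducedFunctional Lbar) := by
  let : MetricSpace X := TopologicalSpace.metrizableSpaceMetric X
  obtain ⟨f, hf, hsurj⟩ := exists_nat_bool_continuous_surjective_of_compact X
  obtain ⟨e, he, heS⟩ := exists_isClosedEmbedding_nat_bool_of_not_countable hS hunc
  obtain ⟨s, hs, hmeas⟩ := exists_section_measurable_comp hf hsurj he.continuous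
  refine ⟨e ∘ s, hmeas, fun x => heS (s x), fun V h1 hV L => ⟨fun hL => ?_, ?_⟩⟩
  · exact hL.exists_isContinuousExtension hmeas (fun x => hSI (heS (s x))) h1
  · rintro ⟨Lbar, hLbar, hmom⟩
    exact hLbar.isMomentFunctional hf he hs hV hmom

theorem corollary4p5 (n k : ℕ) (hn : 1 ≤ n) (hk : 1 ≤ k)
    (C : Fin k → Set (EuclideanSpace ℝ (Fin n)))
    (hcompact : ∀ i, IsCompact (C i))
    (hpath : ∀ i, IsPathConnected (C i))
    (hdisj : Pairwise fun i j => Disjoint (C i) (C j))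
    (K : Set (EuclideanSpace ℝ (Fin n))) (hK : K = ⋃ i, C i) :
    intervalUnion k ⊆ Set.Icc 0 1 ∧
    ∃ g : K → ℝ, Measurable g ∧ (∀ x, g x ∈ intervalUnion k) ∧
      ∀ V : Submodule ℝ (K → ℝ), (1 : K → ℝ) ∈ V → (∀ v ∈ V, Continuous v) →
        ∀ L : V →ₗ[ℝ] ℝ,
          IsMomentFunctional V.subtype L ↔
            ∃ Lbar : ↥(V ⊔ polySpace g) →ₗ[ℝ] ℝ,
              IsContinuousExtension g L Lbar ∧
                IsMomentFunctionalOn (Set.Icc 0 1) (polyComp (id : ℝ → ℝ))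
                  (inducedFunctional Lbar) := by
  subst hK
  have : CompactSpace (⋃ i, C i) := isCompact_iff_compactSpace.1 (isCompact_iUnion hcompact)
  have : Nonempty (⋃ i, C i) :=
    ((hpath ⟨0, hk⟩).nonempty.mono (Set.subset_iUnion C _)).to_subtype
  exact ⟨intervalUnion_subset_Icc k, corollary4p5_general (measurableSet_intervalUnion k)
    (not_countable_intervalUnion hk) (intervalUnion_subset_Icc k)⟩
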